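/- Let $0<r<1$ and let $\mu=\mu(r,1/r)$ be the measure on $\mathbb{R}$ with density $$\Bigl(1+\frac{x}{r}\Bigr)\,\frac{\sqrt{1-r^2}}{\pi(1-x^2)\sqrt{r^2-x^2}}\quad\text{on }(-r,r)$$ and density $0$ elsewhere. Then $\mu$ is a probability measure, and it has a unique pair of sequences of Jacobi parameters $(\beta_n)_{n\ge0}$, $(\gamma_n)_{n\ge0}$, that is, real numbers such that the monic orthogonal polynomials $P_n$ of $\mu$ satisfy $$xP_n(x)=P_{n+1}(x)+\beta_nP_n(x)+\gamma_{n-1}P_{n-1}(x)\qquad(n\ge0),\qquad P_{-1}=0.$$ They are given by $$\beta_0=\frac{1-\sqrt{1-r^2}}{r},\qquad \beta_1=-\frac{(1-\sqrt{1-r^2})^2}{2r},\qquad \beta_n=0\quad(n\ge2),$$ $$\gamma_0=\frac{\sqrt{1-r^2}\,(1-\sqrt{1-r^2})^2}{r^2},\qquad \gamma_n=\frac{r^2}{4}\quad(n\ge1).$$ Moreover, for every $z\in\mathbb{C}\setminus[-r,r]$, $$\int_{\mathbb{R}}\frac{d\mu(x)}{z-x}=\cfrac{1}{z-\beta_0-\cfrac{\gamma_0}{z-\beta_1-\cfrac{\gamma_1}{z-\beta_2-\cfrac{\gamma_2}{\ddots}}}},$$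 where the right-hand side is the limit of the convergents of the continued fraction. -/

import Mathlib

open MeasureTheory Filter Topology Polynomial

noncomputable section

/-- The limit density `k(x : r)` of the rescaled quantum walk: it is
`√(1 - r²) / (π (1 - x²) √(r² - x²))` on `(-r, r)` and `0` elsewhere. -/
def konnoDensity (r x : ℝ) : ℝ :=
  (Set.Ioo (-r) r).indicator
    (fun y => √(1 - r ^ 2) / (Real.pi * (1 - y ^ 2) * √(r ^ 2 - y ^ 2))) x

/-- The measure `μ(r, c)` on `ℝ` with density `(1 + c x) k(x : r)` with respect to Lebesgue
measure. -/
def walkMeasure (r c : ℝ) : Measure ℝ :=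
  volume.withDensity (fun x => ENNReal.ofReal ((1 + c * x) * konnoDensity r x))

/-- The Stieltjes transform `G_μ(z) = ∫ dμ(x) / (z - x)`. -/
def stieltjesTransform (μ : Measure ℝ) (z : ℂ) : ℂ :=
  ∫ x : ℝ, 1 / (z - (x : ℂ)) ∂μ

/-- `P` is the sequence of monic orthogonal polynomials of `μ`
(for a measure with finite moments whose support is infinite). -/
structure IsMonicOrthogonal (μ : Measure ℝ) (P : ℕ → ℝ[X]) : Prop where
  monic : ∀ n, (P n).Monic
  natDegree_eq : ∀ n, (P n).natDegree = n
  orthogonal : ∀ m n, m ≠ n → ∫ x, (P m).eval x * (P n).eval x ∂μ = 0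
  norm_pos : ∀ n, 0 < ∫ x, (P n).eval x ^ 2 ∂μ

/-- `β` and `γ` are the Jacobi parameters of `μ`: all moments of `μ` are finite, and the monic
orthogonal polynomials of `μ` satisfy `x Pₙ = Pₙ₊₁ + βₙ Pₙ + γₙ₋₁ Pₙ₋₁`, with `P₋₁ = 0`. -/
def IsJacobiParameters (μ : Measure ℝ) (β γ : ℕ → ℝ) : Prop :=
  (∀ n : ℕ, Integrable (fun x : ℝ => x ^ n) μ) ∧
  ∃ P : ℕ → ℝ[X], IsMonicOrthogonal μ P ∧
    X * P 0 = P 1 + C (β 0) * P 0 ∧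
    ∀ n, X * P (n + 1) = P (n + 2) + C (β (n + 1)) * P (n + 1) + C (γ n) * P n

/-- The partial numerators `1, -γ₀, -γ₁, …` of the Jacobi continued fraction. -/
def jacobiNumerator (γ : ℕ → ℝ) : ℕ → ℂ
  | 0 => 1
  | n + 1 => -(γ n : ℂ)

/-- The infinite continued fraction `1 / (z - β₀ - γ₀ / (z - β₁ - γ₁ / (z - β₂ - ⋯)))`. -/
def jacobiContFract (β γ : ℕ → ℝ) (z : ℂ) : GenContFract ℂ where
  h := 0
  s := Stream'.Seq.ofStream fun n => ⟨jacobiNumerator γ n, z - (β n : ℂ)⟩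

end

/-! Put `x = r y`. The measure becomes `(1 + y) κ(y)` times the Chebyshev weight `(1 - y²)^(-1/2)`,
with `κ = scaledKernel r` a constant over `1 - r² y²`. Let `m_k` be the integral of `T_k κ` against
that weight and `q = momentRatio r`. Multiplying `κ` by its denominator gives a recurrence whose
solution satisfies `m_0 = 1`, `m_1 = 0`, `m_(k+2) = q m_k`.

With the stated parameters, the recurrence polynomials satisfy `(1 + y) P_(n+1)(r y) = (r/2)^(n+1)
(T_(n+1) + T_(n+2) - q (T_(n-1) + T_n))` (`eval_jacobiPoly_eq_chebyshev`), so every `P_n` with `n ≥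
1` has integral zero. With the recurrence and `γ_n > 0`, this alone forces orthogonality
(`integral_X_pow_mul_jacobiPoly`). Uniqueness of monic orthogonal polynomials gives the converse.

For the continued fraction, the denominators are `P_n(z)` and the error of the `n`-th convergent is
`Q_n(z) / P_n(z)`, where `Q_n(z) = ∫ P_n(x) / (z - x) dμ`. The norms of `P_n` in `L²(μ)` make
`Q_n(z)` of order `(r/2)^n`, while `P_n(z)` grows like `(r/2)^n |w|^n` with `z = r (w + w⁻¹) / 2`
and `|w| > 1`. -/

/-! ### Rescaling to `(-1, 1)` and the Chebyshev moments. -/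

section ChebyshevMoments

open Polynomial.Chebyshev

/-- The density of `walkMeasure r 0`, rescaled to `(-1, 1)`, with respect to `measureT`. -/
noncomputable def scaledKernel (r y : ℝ) : ℝ := √(1 - r ^ 2) / (Real.pi * (1 - r ^ 2 * y ^ 2))

theorem one_sub_sq_mul_sq_pos {r y : ℝ} (hr₀ : 0 < r) (hr₁ : r < 1) (hy : y ∈ Set.Icc (-1 : ℝ) 1) :
    0 < 1 - r ^ 2 * y ^ 2 := by
  have h1 : y ^ 2 ≤ 1 := by
    obtain ⟨h, h'⟩ := hy
    nlinarith
  nlinarith [sq_nonneg y, sq_nonneg r]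

theorem continuousOn_scaledKernel {r : ℝ} (hr₀ : 0 < r) (hr₁ : r < 1) :
    ContinuousOn (scaledKernel r) (Set.Icc (-1) 1) := by
  unfold scaledKernel
  refine ContinuousOn.div (by fun_prop) (by fun_prop) fun y hy => ?_
  have := one_sub_sq_mul_sq_pos hr₀ hr₁ hy
  positivity

theorem walkDensity_eq {r x : ℝ} (hr₀ : 0 < r) :
    (1 + 1 / r * x) * konnoDensity r x = (Set.Ioo (-r) r).indicator
      (fun x => r⁻¹ * ((1 + x / r) * scaledKernel r (x / r) * √(1 - (x / r) ^ 2)⁻¹)) x := by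
  unfold konnoDensity
  by_cases hx : x ∈ Set.Ioo (-r) r
  · simp only [Set.indicator_of_mem hx, scaledKernel]
    have h : r ^ 2 - x ^ 2 = r ^ 2 * (1 - (x / r) ^ 2) := by field_simp
    have h2 : r ^ 2 * (x / r) ^ 2 = x ^ 2 := by field_simp
    rw [h, h2, Real.sqrt_mul (by positivity), Real.sqrt_sq hr₀.le, Real.sqrt_inv]
    simp only [div_eq_mul_inv, mul_inv]
    ring
  · simp [Set.indicator_of_notMem hx]

theorem walkDensity_nonneg {r : ℝ} (hr₀ : 0 < r) (hr₁ : r < 1) (x : ℝ) :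
    0 ≤ (1 + 1 / r * x) * konnoDensity r x := by
  rw [walkDensity_eq hr₀]
  refine Set.indicator_nonneg (fun x hx => ?_) x
  have hy : x / r ∈ Set.Icc (-1 : ℝ) 1 := by
    constructor
    · rw [le_div_iff₀ hr₀]; linarith [hx.1]
    · rw [div_le_iff₀ hr₀]; linarith [hx.2]
  have := one_sub_sq_mul_sq_pos hr₀ hr₁ hy
  have : 0 ≤ 1 + x / r := by linarith [hy.1]
  unfold scaledKernel
  positivity

theorem measurable_walkDensity (r : ℝ) :
    Measurable (fun x => (1 + 1 / r * x) * konnoDensity r x) := by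
  unfold konnoDensity
  refine Measurable.mul (by fun_prop) (Measurable.indicator (by fun_prop) measurableSet_Ioo)

theorem integrable_walkDensity {r : ℝ} (hr₀ : 0 < r) (hr₁ : r < 1) :
    Integrable (fun x => (1 + 1 / r * x) * konnoDensity r x) := by
  simp_rw [walkDensity_eq hr₀]
  rw [integrable_indicator_iff measurableSet_Ioo, ← integrableOn_Ioc_iff_integrableOn_Ioo,
    ← intervalIntegrable_iff_integrableOn_Ioc_of_le (by linarith)]
  have hc : ContinuousOn (fun y => (1 + y) * scaledKernel r y) (Set.uIcc (-1) 1) := by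
    rw [Set.uIcc_of_le (by norm_num)]
    exact ContinuousOn.mul (by fun_prop) (continuousOn_scaledKernel hr₀ hr₁)
  have h := (intervalIntegrable_sqrt_one_sub_sq_inv.continuousOn_mul hc).comp_mul_right (c := r⁻¹)
  have h' := h.const_mul r⁻¹
  simpa [div_eq_mul_inv] using h'

theorem integral_walkMeasure {r : ℝ} (hr₀ : 0 < r) (hr₁ : r < 1) (f : ℝ → ℝ) :
    ∫ x, f x ∂walkMeasure r (1 / r) =
      ∫ y, f (r * y) * ((1 + y) * scaledKernel r y) ∂measureT := by
  rw [walkMeasure, integral_withDensity_eq_integral_toReal_smul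
    (measurable_walkDensity r).ennreal_ofReal (by simp), integral_measureT]
  have h : ∀ x, (ENNReal.ofReal ((1 + 1 / r * x) * konnoDensity r x)).toReal • f x =
      (Set.Ioo (-r) r).indicator (fun x => r⁻¹ * (f (r * (x / r)) *
        ((1 + x / r) * scaledKernel r (x / r)) * √(1 - (x / r) ^ 2)⁻¹)) x := by
    intro x
    rw [ENNReal.toReal_ofReal (walkDensity_nonneg hr₀ hr₁ x), walkDensity_eq hr₀, smul_eq_mul]
    by_cases hx : x ∈ Set.Ioo (-r) r
    · simp only [Set.indicator_of_mem hx]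
      rw [mul_div_cancel₀ x hr₀.ne']
      ring
    · simp [Set.indicator_of_notMem hx]
  simp_rw [h]
  rw [integral_indicator measurableSet_Ioo, ← integral_Ioc_eq_integral_Ioo,
    ← intervalIntegral.integral_of_le (by linarith), intervalIntegral.integral_const_mul,
    intervalIntegral.integral_comp_div (fun y => f (r * y) *
        ((1 + y) * scaledKernel r y) * √(1 - y ^ 2)⁻¹) hr₀.ne', neg_div, div_self hr₀.ne',
    smul_eq_mul, inv_mul_cancel_left₀ hr₀.ne']

theorem ae_walkMeasure (r c : ℝ) : ∀ᵐ x ∂walkMeasure r c, x ∈ Set.Ioo (-r) r := by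
  have hm : Measurable (fun x => ENNReal.ofReal ((1 + c * x) * konnoDensity r x)) := by
    unfold konnoDensity
    exact (Measurable.mul (by fun_prop)
      (Measurable.indicator (by fun_prop) measurableSet_Ioo)).ennreal_ofReal
  rw [walkMeasure, ae_withDensity_iff hm]
  refine Eventually.of_forall fun x hx => ?_
  by_contra h
  simp [konnoDensity, Set.indicator_of_notMem h] at hx

theorem isFiniteMeasure_walkMeasure {r : ℝ} (hr₀ : 0 < r) (hr₁ : r < 1) :
    IsFiniteMeasure (walkMeasure r (1 / r)) :=
  isFiniteMeasure_withDensity_ofReal (integrable_walkDensity hr₀ hr₁).2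

/-- The Chebyshev moments of the rescaled density. -/
noncomputable def chebyshevMoment (r : ℝ) (k : ℤ) : ℝ :=
  ∫ y, (T ℝ k).eval y * scaledKernel r y ∂measureT

theorem integrable_eval_mul_scaledKernel {r : ℝ} (hr₀ : 0 < r) (hr₁ : r < 1) (p : ℝ[X]) :
    Integrable (fun y => p.eval y * scaledKernel r y) measureT :=
  integrable_measureT (ContinuousOn.mul (by fun_prop) (continuousOn_scaledKernel hr₀ hr₁))

/-- The integrand has the antiderivative `arcsin (√(1 - r²) y / √(1 - r² y²)) / π`, which runs from
`-1/2` to `1/2`. -/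
theorem chebyshevMoment_zero {r : ℝ} (hr₀ : 0 < r) (hr₁ : r < 1) : chebyshevMoment r 0 = 1 := by
  have hs : 0 < 1 - r ^ 2 := by nlinarith
  have hss := Real.sq_sqrt hs.le
  have hspos := Real.sqrt_pos.2 hs
  have hcont : ContinuousOn (fun y => Real.arcsin (√(1 - r ^ 2) * y / √(1 - r ^ 2 * y ^ 2)))
      (Set.Icc (-1) 1) := by
    refine Real.continuous_arcsin.comp_continuousOn (ContinuousOn.div (by fun_prop) (by fun_prop)
      fun y hy => ?_)
    exact (Real.sqrt_pos.2 (one_sub_sq_mul_sq_pos hr₀ hr₁ hy)).ne'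
  have hderiv : ∀ y ∈ Set.Ioo (-1 : ℝ) 1,
      HasDerivAt (fun y => Real.arcsin (√(1 - r ^ 2) * y / √(1 - r ^ 2 * y ^ 2)))
        (Real.pi * (scaledKernel r y * √(1 - y ^ 2)⁻¹)) y := by
    intro y hy
    have hD := one_sub_sq_mul_sq_pos hr₀ hr₁ (Set.Ioo_subset_Icc_self hy)
    have hD' := Real.sqrt_pos.2 hD
    have hDs := Real.sq_sqrt hD.le
    have hE : 0 < 1 - y ^ 2 := by nlinarith [hy.1, hy.2]
    have hE' := Real.sqrt_pos.2 hE
    have hu : 1 - (√(1 - r ^ 2) * y / √(1 - r ^ 2 * y ^ 2)) ^ 2 =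
        (1 - y ^ 2) / (1 - r ^ 2 * y ^ 2) := by
      rw [div_pow, mul_pow, hss, hDs]
      field_simp
      ring
    have hlt : (√(1 - r ^ 2) * y / √(1 - r ^ 2 * y ^ 2)) ^ 2 < 1 := by
      have : 0 < (1 - y ^ 2) / (1 - r ^ 2 * y ^ 2) := by positivity
      linarith
    have habs := (sq_lt_one_iff_abs_lt_one _).1 hlt
    rw [abs_lt] at habs
    have h1 : HasDerivAt (fun y : ℝ => 1 - r ^ 2 * y ^ 2) (-(r ^ 2 * (2 * y))) y := by
      have := ((hasDerivAt_pow 2 y).const_mul (r ^ 2)).const_sub 1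
      simpa using this
    have h2 := ((hasDerivAt_id y).const_mul (√(1 - r ^ 2))).div (h1.sqrt hD.ne') hD'.ne'
    have h3 := (Real.hasDerivAt_arcsin habs.1.ne' habs.2.ne).comp y h2
    refine h3.congr_deriv ?_
    rw [id, hu, Real.sqrt_div hE.le, hDs, Real.sqrt_inv]
    unfold scaledKernel
    set t := √(1 - r ^ 2 * y ^ 2)
    rw [← hDs]
    field_simp
    linear_combination hDs
  -- A nonnegative derivative of a function continuous up to the endpoints is integrable, so the
  -- endpoint singularities need no estimate.
  have hint := (intervalIntegral.integrableOn_deriv_of_nonneg hcont hderiv) (fun y hy => by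
    have := one_sub_sq_mul_sq_pos hr₀ hr₁ (Set.Ioo_subset_Icc_self hy)
    unfold scaledKernel
    positivity)
  have h := intervalIntegral.integral_eq_sub_of_hasDerivAt_of_le (by norm_num) hcont hderiv
    ((intervalIntegrable_iff_integrableOn_Ioc_of_le (by norm_num)).2 hint)
  rw [intervalIntegral.integral_const_mul] at h
  have e1 : √(1 - r ^ 2) * 1 / √(1 - r ^ 2 * 1 ^ 2) = 1 := by
    rw [mul_one, one_pow, mul_one, div_self hspos.ne']
  have e2 : √(1 - r ^ 2) * -1 / √(1 - r ^ 2 * (-1) ^ 2) = -1 := by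
    rw [mul_neg, mul_one, neg_one_sq, mul_one, neg_div, div_self hspos.ne']
  rw [e1, e2, Real.arcsin_neg, Real.arcsin_one] at h
  rw [chebyshevMoment, integral_measureT]
  simp only [T_zero, eval_one, one_mul]
  have hpi := Real.pi_pos
  apply mul_left_cancel₀ hpi.ne'
  linarith

theorem chebyshevMoment_one (r : ℝ) : chebyshevMoment r 1 = 0 := by
  rw [chebyshevMoment, integral_measureT]
  simp only [T_one, eval_X]
  have h := intervalIntegral.integral_comp_neg (a := -1) (b := 1)
    (fun y => y * scaledKernel r y * √(1 - y ^ 2)⁻¹)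
  simp only [neg_neg, scaledKernel, neg_sq, neg_mul, intervalIntegral.integral_neg] at h
  simp only [scaledKernel]
  linarith

theorem chebyshevMoment_neg (r : ℝ) (k : ℤ) : chebyshevMoment r (-k) = chebyshevMoment r k := by
  simp [chebyshevMoment]

/-- `κ(y) (1 - r² y²)` is constant, and `4 y² T_k = T_(k+2) + 2 T_k + T_(k-2)`. -/
theorem chebyshevMoment_rec {r : ℝ} (hr₀ : 0 < r) (hr₁ : r < 1) (k : ℤ) :
    (1 - r ^ 2 / 2) * chebyshevMoment r k -
      r ^ 2 / 4 * (chebyshevMoment r (k + 2) + chebyshevMoment r (k - 2)) =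
      √(1 - r ^ 2) / Real.pi * ∫ y, (T ℝ k).eval y ∂measureT := by
  have hi := fun j => integrable_eval_mul_scaledKernel hr₀ hr₁ (T ℝ j)
  unfold chebyshevMoment
  rw [← integral_add (hi _) (hi _), ← integral_const_mul, ← integral_const_mul,
    ← integral_const_mul, ← integral_sub ((hi k).const_mul (1 - r ^ 2 / 2))
      (g := fun y => r ^ 2 / 4 * ((T ℝ (k + 2)).eval y * scaledKernel r y +
        (T ℝ (k - 2)).eval y * scaledKernel r y)) (((hi _).add (hi _)).const_mul _),
    integral_measureT, integral_measureT]
  refine intervalIntegral.integral_congr fun y hy => ?_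
  rw [Set.uIcc_of_le (by norm_num)] at hy
  have hD := one_sub_sq_mul_sq_pos hr₀ hr₁ hy
  have h1 := congrArg (eval y) (T_add_two ℝ k)
  have h2 := congrArg (eval y) (T_sub_two ℝ k)
  have h3 := congrArg (eval y) (T_add_one ℝ k)
  simp only [eval_sub, eval_mul, eval_X, eval_ofNat] at h1 h2 h3
  have h4 : (T ℝ (k + 2)).eval y + (T ℝ (k - 2)).eval y = (4 * y ^ 2 - 2) * (T ℝ k).eval y := by
    rw [h1, h2, h3]; ring
  have h5 : scaledKernel r y * (1 - r ^ 2 * y ^ 2) = √(1 - r ^ 2) / Real.pi := by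
    unfold scaledKernel
    have := Real.pi_pos
    field_simp
  rw [← h5, ← add_mul, h4]
  ring

/-- The ratio of consecutive even Chebyshev moments. -/
noncomputable def momentRatio (r : ℝ) : ℝ := (1 - √(1 - r ^ 2)) ^ 2 / r ^ 2

/-- This is the characteristic equation of `chebyshevMoment_rec` for `k ≠ 0`, in steps of two. -/
theorem momentRatio_quadratic {r : ℝ} (hr₀ : 0 < r) (hr₁ : r < 1) :
    r ^ 2 / 4 * (momentRatio r ^ 2 + 1) = (1 - r ^ 2 / 2) * momentRatio r := by
  have hs : 0 < 1 - r ^ 2 := by nlinarith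
  have hss := Real.sq_sqrt hs.le
  unfold momentRatio
  set s := √(1 - r ^ 2)
  have hr : r ^ 2 = 1 - s ^ 2 := by linarith
  have hne : (1 - s ^ 2) ≠ 0 := by rw [← hr]; positivity
  rw [hr]
  field_simp
  ring

theorem chebyshevMoment_add_two {r : ℝ} (hr₀ : 0 < r) (hr₁ : r < 1) (n : ℕ) :
    chebyshevMoment r (n + 2) = momentRatio r * chebyshevMoment r n := by
  have hs : 0 < 1 - r ^ 2 := by nlinarith
  have hss := Real.sq_sqrt hs.le
  induction n using Nat.twoStepInduction with
  | zero =>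
    -- At `k = 0` the right side is `√(1 - r²)`; since `m_(-2) = m_2`, this determines `m_2`.
    have h := chebyshevMoment_rec hr₀ hr₁ 0
    have hn := chebyshevMoment_neg r 2
    rw [integral_eval_T_real_measureT_zero, div_mul_cancel₀ _ Real.pi_pos.ne', zero_sub, hn,
      zero_add, chebyshevMoment_zero hr₀ hr₁] at h
    simp only [Nat.cast_zero, zero_add, chebyshevMoment_zero hr₀ hr₁]
    unfold momentRatio
    field_simp
    nlinarith
  | one =>
    have h := chebyshevMoment_rec hr₀ hr₁ 1
    have hn := chebyshevMoment_neg r 1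
    rw [integral_eval_T_real_measureT_of_ne_zero one_ne_zero,
      show (1 : ℤ) - 2 = -1 by norm_num, hn, chebyshevMoment_one] at h
    rw [Nat.cast_one, chebyshevMoment_one]
    have : r ^ 2 ≠ 0 := by positivity
    simp only [mul_zero, add_zero, zero_sub, neg_eq_zero, mul_eq_zero] at h ⊢
    rcases h with h | h
    · exact absurd h (by positivity)
    · exact h
  | more n ih _ =>
    have h := chebyshevMoment_rec hr₀ hr₁ (n + 2 : ℤ)
    rw [integral_eval_T_real_measureT_of_ne_zero (by omega), mul_zero, add_sub_cancel_right,
      ih] at h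
    push_cast
    rw [ih]
    have hq := momentRatio_quadratic hr₀ hr₁
    have h' : r ^ 2 / 4 * chebyshevMoment r (n + 2 + 2) =
        r ^ 2 / 4 * (momentRatio r * (momentRatio r * chebyshevMoment r n)) := by
      linear_combination (-1) * h - hq * chebyshevMoment r n
    exact mul_left_cancel₀ (by positivity) h'

theorem integral_one_walkMeasure {r : ℝ} (hr₀ : 0 < r) (hr₁ : r < 1) :
    ∫ _, (1 : ℝ) ∂walkMeasure r (1 / r) = 1 := by
  rw [integral_walkMeasure hr₀ hr₁]
  have hi := fun j => integrable_eval_mul_scaledKernel hr₀ hr₁ (T ℝ j)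
  have h : chebyshevMoment r 0 + chebyshevMoment r 1 =
      ∫ y, 1 * ((1 + y) * scaledKernel r y) ∂measureT := by
    unfold chebyshevMoment
    rw [← integral_add (hi _) (hi _)]
    simp [add_mul]
  rw [← h, chebyshevMoment_zero hr₀ hr₁, chebyshevMoment_one, add_zero]

theorem isProbabilityMeasure_walkMeasure {r : ℝ} (hr₀ : 0 < r) (hr₁ : r < 1) :
    IsProbabilityMeasure (walkMeasure r (1 / r)) := by
  have := isFiniteMeasure_walkMeasure hr₀ hr₁
  have h := integral_one_walkMeasure hr₀ hr₁
  rw [integral_const, smul_eq_mul, mul_one] at h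
  exact ⟨by rwa [Measure.real, ENNReal.toReal_eq_one_iff] at h⟩

end ChebyshevMoments

/-! ### Polynomials of a three-term recurrence. -/

/-- The monic polynomials defined by the three-term recurrence with coefficients `β` and `γ`. -/
noncomputable def jacobiPoly (β γ : ℕ → ℝ) : ℕ → ℝ[X]
  | 0 => 1
  | 1 => X - C (β 0)
  | n + 2 => (X - C (β (n + 1))) * jacobiPoly β γ (n + 1) - C (γ n) * jacobiPoly β γ n

theorem jacobiPoly_monic_natDegree (β γ : ℕ → ℝ) (n : ℕ) :
    (jacobiPoly β γ n).Monic ∧ (jacobiPoly β γ n).natDegree = n := by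
  induction n using Nat.twoStepInduction with
  | zero => simp [jacobiPoly]
  | one => exact ⟨monic_X_sub_C _, natDegree_X_sub_C _⟩
  | more n ih₀ ih₁ =>
    have hm : ((X - C (β (n + 1))) * jacobiPoly β γ (n + 1)).Monic := (monic_X_sub_C _).mul ih₁.1
    have hd : ((X - C (β (n + 1))) * jacobiPoly β γ (n + 1)).natDegree = n + 2 := by
      rw [(monic_X_sub_C _).natDegree_mul ih₁.1, natDegree_X_sub_C, ih₁.2]
      omega
    have hlt : (C (γ n) * jacobiPoly β γ n).natDegree <
        ((X - C (β (n + 1))) * jacobiPoly β γ (n + 1)).natDegree := by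
      rw [hd]
      have := natDegree_C_mul_le (γ n) (jacobiPoly β γ n)
      omega
    rw [jacobiPoly]
    exact ⟨hm.sub_of_left (degree_lt_degree hlt),
      (natDegree_sub_eq_left_of_natDegree_lt hlt).trans hd⟩

/-! ### Uniqueness of monic orthogonal polynomials and of Jacobi parameters. -/

theorem integrable_eval_of_integrable_pow {μ : Measure ℝ}
    (hμ : ∀ n : ℕ, Integrable (fun x : ℝ => x ^ n) μ) (p : ℝ[X]) :
    Integrable (fun x => p.eval x) μ := by
  simp_rw [eval_eq_sum_range]
  exact integrable_finsetSum _ fun i _ => (hμ i).const_mul _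

theorem integral_eval_sub {μ : Measure ℝ}
    (hμ : ∀ n : ℕ, Integrable (fun x : ℝ => x ^ n) μ) (p q : ℝ[X]) :
    ∫ x, (p - q).eval x ∂μ = ∫ x, p.eval x ∂μ - ∫ x, q.eval x ∂μ := by
  simp_rw [eval_sub]
  exact integral_sub (integrable_eval_of_integrable_pow hμ p)
    (integrable_eval_of_integrable_pow hμ q)

theorem integral_eval_add {μ : Measure ℝ}
    (hμ : ∀ n : ℕ, Integrable (fun x : ℝ => x ^ n) μ) (p q : ℝ[X]) :
    ∫ x, (p + q).eval x ∂μ = ∫ x, p.eval x ∂μ + ∫ x, q.eval x ∂μ := by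
  simp_rw [eval_add]
  exact integral_add (integrable_eval_of_integrable_pow hμ p)
    (integrable_eval_of_integrable_pow hμ q)

theorem integral_eval_C_mul {μ : Measure ℝ} (c : ℝ) (p : ℝ[X]) :
    ∫ x, (C c * p).eval x ∂μ = c * ∫ x, p.eval x ∂μ := by
  simp_rw [eval_mul, eval_C]
  exact integral_const_mul _ _

/-- The monic orthogonal polynomial `P n` is orthogonal to every polynomial of degree less than
some `d ≤ n`. -/
theorem integral_mul_eq_zero_of_natDegree_lt {μ : Measure ℝ} {P : ℕ → ℝ[X]}
    (hμ : ∀ n : ℕ, Integrable (fun x : ℝ => x ^ n) μ) (hP : IsMonicOrthogonal μ P) (n : ℕ) :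
    ∀ (d : ℕ) (E : ℝ[X]), d ≤ n → E.natDegree < d ∨ E = 0 →
      ∫ x, (E * P n).eval x ∂μ = 0 := by
  intro d
  induction d with
  | zero =>
    intro E _ hE
    obtain h | rfl := hE
    · omega
    · simp
  | succ d ih =>
    intro E hd hE
    have hdeg : E.degree < (d + 1 : ℕ) := by
      rcases hE with h | rfl
      · exact degree_le_natDegree.trans_lt (by exact_mod_cast h)
      · simp
    -- Since `P d` is monic of degree `d`, subtracting this multiple cancels the coefficient of `X ^
    -- d`.
    have hE' : (E - C (E.coeff d) * P d).degree < (d : ℕ) := by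
      rw [degree_lt_iff_coeff_zero]
      intro m hm
      rw [degree_lt_iff_coeff_zero] at hdeg
      rw [coeff_sub, coeff_C_mul]
      rcases hm.eq_or_lt with rfl | hm
      · have := (hP.monic d).coeff_natDegree
        rw [hP.natDegree_eq] at this
        simp [this]
      · rw [hdeg m hm, coeff_eq_zero_of_natDegree_lt (p := P d) (by rw [hP.natDegree_eq]; exact hm)]
        simp
    have hE'' : (E - C (E.coeff d) * P d).natDegree < d ∨ E - C (E.coeff d) * P d = 0 := by
      by_cases h : E - C (E.coeff d) * P d = 0
      · exact Or.inr h
      · exact Or.inl ((natDegree_lt_iff_degree_lt h).2 hE')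
    have key := ih _ (by omega) hE''
    have horth := hP.orthogonal d n (by omega)
    rw [sub_mul, integral_eval_sub hμ, mul_assoc, integral_eval_C_mul] at key
    simp_rw [eval_mul] at key horth ⊢
    rw [horth] at key
    linarith

/-- The monic orthogonal polynomials of a measure are unique. -/
theorem IsMonicOrthogonal.unique {μ : Measure ℝ} {P Q : ℕ → ℝ[X]}
    (hμ : ∀ n : ℕ, Integrable (fun x : ℝ => x ^ n) μ) (hP : IsMonicOrthogonal μ P)
    (hQ : IsMonicOrthogonal μ Q) : P = Q := by
  funext n
  by_contra hne
  have hD : P n - Q n ≠ 0 := sub_ne_zero.2 hne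
  set D := P n - Q n with hDdef
  have hdeg : D.natDegree < n := by
    rw [natDegree_lt_iff_degree_lt hD, degree_lt_iff_coeff_zero]
    intro m hm
    rw [hDdef, coeff_sub]
    rcases hm.eq_or_lt with rfl | hm
    · have h1 := (hP.monic n).coeff_natDegree
      have h2 := (hQ.monic n).coeff_natDegree
      rw [hP.natDegree_eq] at h1
      rw [hQ.natDegree_eq] at h2
      rw [h1, h2, sub_self]
    · rw [coeff_eq_zero_of_natDegree_lt (by rw [hP.natDegree_eq]; exact hm),
        coeff_eq_zero_of_natDegree_lt (by rw [hQ.natDegree_eq]; exact hm), sub_self]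
  -- Test `D` against `P d`, `d = deg D < n`. Both `P n` and `Q n` are orthogonal to `P d`, so the
  -- integral of `D * P d` vanishes; it also equals the leading coefficient of `D` times the
  -- positive norm of `P d`.
  have hPd : (P D.natDegree).natDegree < n := by rwa [hP.natDegree_eq]
  have h1 := integral_mul_eq_zero_of_natDegree_lt hμ hP n n (P D.natDegree) le_rfl (Or.inl hPd)
  have h2 := integral_mul_eq_zero_of_natDegree_lt hμ hQ n n (P D.natDegree) le_rfl (Or.inl hPd)
  have h3 : ∫ x, (D * P D.natDegree).eval x ∂μ = 0 := by
    rw [hDdef, sub_mul, integral_eval_sub hμ, ← hDdef, mul_comm, h1, mul_comm, h2, sub_zero]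
  have hlow : (D - C D.leadingCoeff * P D.natDegree).natDegree < D.natDegree ∨
      D - C D.leadingCoeff * P D.natDegree = 0 := by
    by_cases h : D - C D.leadingCoeff * P D.natDegree = 0
    · exact Or.inr h
    · refine Or.inl ((natDegree_lt_iff_degree_lt h).2 ?_)
      rw [degree_lt_iff_coeff_zero]
      intro m hm
      rw [coeff_sub, coeff_C_mul]
      rcases hm.eq_or_lt with rfl | hm
      · have := (hP.monic D.natDegree).coeff_natDegree
        rw [hP.natDegree_eq] at this
        simp [this]
      · rw [coeff_eq_zero_of_natDegree_lt hm,
          coeff_eq_zero_of_natDegree_lt (by rw [hP.natDegree_eq]; exact hm)]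
        simp
  have h4 := integral_mul_eq_zero_of_natDegree_lt hμ hP D.natDegree D.natDegree _ le_rfl hlow
  rw [sub_mul, integral_eval_sub hμ, h3, mul_assoc, integral_eval_C_mul, zero_sub, neg_eq_zero]
    at h4
  have h5 := hP.norm_pos D.natDegree
  simp_rw [sq, ← eval_mul] at h5
  rcases mul_eq_zero.1 h4 with h | h
  · exact hD (leadingCoeff_eq_zero.1 h)
  · exact h5.ne' h

/-- Compare the coefficients of `X ^ (n + 1)`, then of `X ^ n`. -/
theorem isMonicOrthogonal_recurrence_unique {μ : Measure ℝ} {P : ℕ → ℝ[X]}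
    (hP : IsMonicOrthogonal μ P) (n : ℕ) {b b' c c' : ℝ}
    (h : C b * P (n + 1) + C c * P n = C b' * P (n + 1) + C c' * P n) : b = b' ∧ c = c' := by
  have hc : ∀ k, (P k).coeff k = 1 := fun k => by
    have := (hP.monic k).coeff_natDegree
    rwa [hP.natDegree_eq] at this
  have hz : (P n).coeff (n + 1) = 0 :=
    coeff_eq_zero_of_natDegree_lt (by rw [hP.natDegree_eq]; omega)
  have h1 := congrArg (fun p => p.coeff (n + 1)) h
  have hb : b = b' := by simpa [coeff_C_mul, hc, hz] using h1
  subst hb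
  have h2 := congrArg (fun p => p.coeff n) (add_left_cancel h)
  exact ⟨rfl, by simpa [coeff_C_mul, hc] using h2⟩

/-- Jacobi parameters are unique. -/
theorem IsJacobiParameters.unique {μ : Measure ℝ} {β γ β' γ' : ℕ → ℝ}
    (h : IsJacobiParameters μ β γ) (h' : IsJacobiParameters μ β' γ') : β = β' ∧ γ = γ' := by
  obtain ⟨hμ, P, hP, h0, hn⟩ := h
  obtain ⟨-, Q, hQ, h0', hn'⟩ := h'
  obtain rfl := hP.unique hμ hQ
  have key : ∀ n, β (n + 1) = β' (n + 1) ∧ γ n = γ' n := fun n => by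
    apply isMonicOrthogonal_recurrence_unique hP n
    have := (hn n).symm.trans (hn' n)
    rw [add_assoc, add_assoc] at this
    exact add_left_cancel this
  refine ⟨funext fun n => ?_, funext fun n => (key n).2⟩
  cases n with
  | zero =>
    have h1 : C (β 0) * P 0 = C (β' 0) * P 0 := add_left_cancel (h0.symm.trans h0')
    have h2 := mul_right_cancel₀ (hP.monic 0).ne_zero h1
    exact C_injective h2
  | succ n => exact (key n).1

/-! ### Orthogonality from vanishing integrals. -/

theorem X_mul_jacobiPoly_zero (β γ : ℕ → ℝ) :
    X * jacobiPoly β γ 0 = jacobiPoly β γ 1 + C (β 0) * jacobiPoly β γ 0 := by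
  simp [jacobiPoly]

theorem X_mul_jacobiPoly_succ (β γ : ℕ → ℝ) (n : ℕ) :
    X * jacobiPoly β γ (n + 1) = jacobiPoly β γ (n + 2) + C (β (n + 1)) * jacobiPoly β γ (n + 1) +
      C (γ n) * jacobiPoly β γ n := by
  rw [jacobiPoly]
  ring

/-- If the polynomials of positive degree in a three-term recurrence integrate to zero, then the
recurrence polynomials satisfy `∫ X ^ k Pₙ = 0` for `k < n` and `∫ X ^ n Pₙ = γ₀ ⋯ γₙ₋₁`. -/
theorem integral_X_pow_mul_jacobiPoly {μ : Measure ℝ} [IsProbabilityMeasure μ] {β γ : ℕ → ℝ}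
    (hμ : ∀ n : ℕ, Integrable (fun x : ℝ => x ^ n) μ)
    (h0 : ∀ n, ∫ x, (jacobiPoly β γ (n + 1)).eval x ∂μ = 0) (k : ℕ) :
    (∀ n, k < n → ∫ x, (X ^ k * jacobiPoly β γ n).eval x ∂μ = 0) ∧
      ∫ x, (X ^ k * jacobiPoly β γ k).eval x ∂μ = ∏ i ∈ Finset.range k, γ i := by
  induction k with
  | zero =>
    refine ⟨fun n hn => ?_, by simp [jacobiPoly]⟩
    obtain ⟨m, rfl⟩ := Nat.exists_eq_succ_of_ne_zero hn.ne'
    simpa using h0 m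
  | succ k ih =>
    -- One factor `X` is absorbed by the recurrence; for index above `k + 1` all three terms vanish
    -- by induction, and at `k + 1` only the `γ` term survives.
    have step : ∀ n, ∫ x, (X ^ (k + 1) * jacobiPoly β γ (n + 1)).eval x ∂μ =
        ∫ x, (X ^ k * jacobiPoly β γ (n + 2)).eval x ∂μ +
        β (n + 1) * ∫ x, (X ^ k * jacobiPoly β γ (n + 1)).eval x ∂μ +
        γ n * ∫ x, (X ^ k * jacobiPoly β γ n).eval x ∂μ := by
      intro n
      rw [← integral_eval_C_mul, ← integral_eval_C_mul, ← integral_eval_add hμ,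
        ← integral_eval_add hμ, pow_succ, mul_assoc, X_mul_jacobiPoly_succ]
      congr! 3
      ring
    refine ⟨fun n hn => ?_, ?_⟩
    · obtain ⟨m, rfl⟩ := Nat.exists_eq_succ_of_ne_zero (by omega : n ≠ 0)
      rw [Nat.succ_eq_add_one, step, ih.1 _ (by omega), ih.1 _ (by omega), ih.1 _ (by omega)]
      ring
    · rw [step, ih.1 _ (by omega), ih.1 _ (by omega), ih.2, Finset.prod_range_succ]
      ring

theorem integral_mul_jacobiPoly {μ : Measure ℝ} [IsProbabilityMeasure μ] {β γ : ℕ → ℝ}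
    (hμ : ∀ n : ℕ, Integrable (fun x : ℝ => x ^ n) μ)
    (h0 : ∀ n, ∫ x, (jacobiPoly β γ (n + 1)).eval x ∂μ = 0) {n : ℕ} {E : ℝ[X]}
    (hE : E.natDegree ≤ n) :
    ∫ x, (E * jacobiPoly β γ n).eval x ∂μ = E.coeff n * ∏ i ∈ Finset.range n, γ i := by
  have h : ∀ i ∈ Finset.range (n + 1),
      Integrable (fun x => (C (E.coeff i) * (X ^ i * jacobiPoly β γ n)).eval x) μ :=
    fun i _ => integrable_eval_of_integrable_pow hμ _
  have hsum : ∀ x, (E * jacobiPoly β γ n).eval x =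
      ∑ i ∈ Finset.range (n + 1), (C (E.coeff i) * (X ^ i * jacobiPoly β γ n)).eval x := by
    intro x
    rw [eval_mul, eval_eq_sum_range' (Nat.lt_succ_of_le hE), Finset.sum_mul]
    refine Finset.sum_congr rfl fun i _ => ?_
    simp [mul_assoc]
  simp_rw [hsum]
  rw [integral_finsetSum _ h, Finset.sum_range_succ, Finset.sum_eq_zero, zero_add,
    integral_eval_C_mul, (integral_X_pow_mul_jacobiPoly hμ h0 n).2]
  intro i hi
  rw [integral_eval_C_mul, (integral_X_pow_mul_jacobiPoly hμ h0 i).1 n (Finset.mem_range.1 hi),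
    mul_zero]

theorem integral_jacobiPoly_sq {μ : Measure ℝ} [IsProbabilityMeasure μ] {β γ : ℕ → ℝ}
    (hμ : ∀ n : ℕ, Integrable (fun x : ℝ => x ^ n) μ)
    (h0 : ∀ n, ∫ x, (jacobiPoly β γ (n + 1)).eval x ∂μ = 0) (n : ℕ) :
    ∫ x, (jacobiPoly β γ n).eval x ^ 2 ∂μ = ∏ i ∈ Finset.range n, γ i := by
  obtain ⟨hm, hd⟩ := jacobiPoly_monic_natDegree β γ n
  have hc := hm.coeff_natDegree
  rw [hd] at hc
  simp_rw [sq, ← eval_mul]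
  rw [integral_mul_jacobiPoly hμ h0 hd.le, hc, one_mul]

theorem isMonicOrthogonal_jacobiPoly {μ : Measure ℝ} [IsProbabilityMeasure μ] {β γ : ℕ → ℝ}
    (hμ : ∀ n : ℕ, Integrable (fun x : ℝ => x ^ n) μ)
    (h0 : ∀ n, ∫ x, (jacobiPoly β γ (n + 1)).eval x ∂μ = 0) (hγ : ∀ n, 0 < γ n) :
    IsMonicOrthogonal μ (jacobiPoly β γ) := by
  have hd := fun n => (jacobiPoly_monic_natDegree β γ n).2
  have hlt : ∀ m n, m < n →
      ∫ x, (jacobiPoly β γ m).eval x * (jacobiPoly β γ n).eval x ∂μ = 0 := fun m n hmn => by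
    simp_rw [← eval_mul]
    rw [integral_mul_jacobiPoly hμ h0 ((hd m).trans_le hmn.le),
      coeff_eq_zero_of_natDegree_lt ((hd m).trans_lt hmn), zero_mul]
  refine ⟨fun n => (jacobiPoly_monic_natDegree β γ n).1, hd, fun m n hmn => ?_, fun n => ?_⟩
  · rcases hmn.lt_or_gt with h | h
    · exact hlt m n h
    · rw [← hlt n m h]
      exact integral_congr_ae (.of_forall fun x => mul_comm _ _)
  · rw [integral_jacobiPoly_sq hμ h0]
    exact Finset.prod_pos fun i _ => hγ i

/-! ### The explicit parameters, and closed forms of their polynomials. -/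

theorem parameters_eq_momentRatio {r : ℝ} (hr₀ : 0 < r) (hr₁ : r < 1) :
    (1 - √(1 - r ^ 2)) / r = r / 2 * (1 + momentRatio r) ∧
    -(1 - √(1 - r ^ 2)) ^ 2 / (2 * r) = -(r / 2) * momentRatio r ∧
    √(1 - r ^ 2) * (1 - √(1 - r ^ 2)) ^ 2 / r ^ 2 = r ^ 2 / 4 * (1 - momentRatio r ^ 2) := by
  have hs : 0 < 1 - r ^ 2 := by nlinarith
  have hss := Real.sq_sqrt hs.le
  unfold momentRatio
  set s := √(1 - r ^ 2)
  refine ⟨?_, ?_, ?_⟩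
  · field_simp
    linear_combination -hss
  · field_simp
  · have hr : r ^ 4 = (1 - s ^ 2) ^ 2 := by rw [hss]; ring
    field_simp
    rw [hr]
    ring

theorem momentRatio_lt_one {r : ℝ} (hr₀ : 0 < r) (hr₁ : r < 1) : momentRatio r < 1 := by
  have hs : 0 < 1 - r ^ 2 := by nlinarith
  have hss := Real.sq_sqrt hs.le
  have hpos := Real.sqrt_pos.2 hs
  unfold momentRatio
  rw [div_lt_one (by positivity)]
  have hlt : √(1 - r ^ 2) < 1 := by
    by_contra hle
    nlinarith
  nlinarith [mul_pos hpos (sub_pos.2 hlt)]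

theorem momentRatio_nonneg (r : ℝ) : 0 ≤ momentRatio r := by
  unfold momentRatio
  positivity

section Parameters

variable {r : ℝ} {β γ : ℕ → ℝ}

-- From `n = 2` on, the recurrence is the Chebyshev one scaled by `r / 2`, so both sides propagate
-- alike; the exceptional `β 0`, `β 1`, `γ 0` matter only in the two base cases. The factor `1 + y`
-- is the one in the density.
open Polynomial.Chebyshev in
theorem eval_jacobiPoly_eq_chebyshev (h0 : β 0 = r / 2 * (1 + momentRatio r))
    (h1 : β 1 = -(r / 2) * momentRatio r) (hβ : ∀ n, 2 ≤ n → β n = 0)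
    (hγ0 : γ 0 = r ^ 2 / 4 * (1 - momentRatio r ^ 2)) (hγ : ∀ n, 1 ≤ n → γ n = r ^ 2 / 4)
    (y : ℝ) (n : ℕ) :
    (1 + y) * (jacobiPoly β γ (n + 1)).eval (r * y) = (r / 2) ^ (n + 1) *
      ((T ℝ (n + 1)).eval y + (T ℝ (n + 2)).eval y -
        momentRatio r * ((T ℝ (n - 1)).eval y + (T ℝ n).eval y)) := by
  have hT : ∀ k : ℤ, (T ℝ (k + 2)).eval y = 2 * y * (T ℝ (k + 1)).eval y - (T ℝ k).eval y := by
    intro k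
    have := congrArg (eval y) (T_add_two ℝ k)
    simpa only [eval_sub, eval_mul, eval_X, eval_ofNat] using this
  have e0 : (T ℝ 0).eval y = 1 := by simp
  have e1 : (T ℝ 1).eval y = y := by simp
  have e2 : (T ℝ 2).eval y = 2 * y * y - 1 := by
    have := hT 0
    rwa [zero_add, zero_add, e0, e1] at this
  have e3 : (T ℝ 3).eval y = 2 * y * (2 * y * y - 1) - y := by
    have := hT 1
    norm_num at this
    rwa [e2] at this
  induction n using Nat.twoStepInduction with
  | zero =>
    simp only [jacobiPoly, zero_add, h0, Nat.cast_zero, zero_sub, T_neg, e0, e1, e2, eval_sub,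
      eval_X, eval_C]
    ring
  | one =>
    norm_num [jacobiPoly, h0, h1, hγ0, e0, e1, e2, e3]
    ring
  | more n ih₀ ih₁ =>
    have a1 := hT (n - 1)
    have a2 := hT n
    have a3 := hT (n + 1)
    have a4 := hT (n + 2)
    rw [show (n : ℤ) - 1 + 2 = n + 1 by ring, show (n : ℤ) - 1 + 1 = n by ring] at a1
    rw [show (n : ℤ) + 1 + 2 = n + 3 by ring, show (n : ℤ) + 1 + 1 = n + 2 by ring] at a3
    rw [show (n : ℤ) + 2 + 2 = n + 4 by ring, show (n : ℤ) + 2 + 1 = n + 3 by ring] at a4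
    rw [jacobiPoly, hβ _ (by omega), hγ _ (by omega)]
    push_cast at ih₁ ⊢
    rw [show (n : ℤ) + 1 + 1 = n + 2 by ring, show (n : ℤ) + 1 + 2 = n + 3 by ring,
      show (n : ℤ) + 1 - 1 = n by ring] at ih₁
    rw [show (n : ℤ) + 2 + 1 = n + 3 by ring, show (n : ℤ) + 2 + 2 = n + 4 by ring,
      show (n : ℤ) + 2 - 1 = n + 1 by ring]
    simp only [eval_sub, eval_mul, eval_X, eval_C, sub_zero]
    have expand : (1 + y) * (r * y * (jacobiPoly β γ (n + 1 + 1)).eval (r * y) -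
        r ^ 2 / 4 * (jacobiPoly β γ (n + 1)).eval (r * y)) =
        r * y * ((1 + y) * (jacobiPoly β γ (n + 1 + 1)).eval (r * y)) -
          r ^ 2 / 4 * ((1 + y) * (jacobiPoly β γ (n + 1)).eval (r * y)) := by ring
    refine expand.trans ?_
    rw [ih₀, ih₁, a4, a3, a2, a1]
    ring

-- The closed form pairs `m_(n+1)` with `q m_(n-1)` and `m_(n+2)` with `q m_n`; both pairs cancel.
open Polynomial.Chebyshev in
theorem integral_jacobiPoly_eq_zero (hr₀ : 0 < r) (hr₁ : r < 1)
    (h0 : β 0 = r / 2 * (1 + momentRatio r))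
    (h1 : β 1 = -(r / 2) * momentRatio r) (hβ : ∀ n, 2 ≤ n → β n = 0)
    (hγ0 : γ 0 = r ^ 2 / 4 * (1 - momentRatio r ^ 2)) (hγ : ∀ n, 1 ≤ n → γ n = r ^ 2 / 4)
    (n : ℕ) : ∫ x, (jacobiPoly β γ (n + 1)).eval x ∂walkMeasure r (1 / r) = 0 := by
  rw [integral_walkMeasure hr₀ hr₁]
  have h : ∀ y, (jacobiPoly β γ (n + 1)).eval (r * y) * ((1 + y) * scaledKernel r y) =
      (r / 2) ^ (n + 1) * (((T ℝ (n + 1)).eval y * scaledKernel r y +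
        (T ℝ (n + 2)).eval y * scaledKernel r y) -
        momentRatio r * ((T ℝ (n - 1)).eval y * scaledKernel r y +
          (T ℝ n).eval y * scaledKernel r y)) := by
    intro y
    linear_combination scaledKernel r y *
      eval_jacobiPoly_eq_chebyshev h0 h1 hβ hγ0 hγ y n
  simp_rw [h]
  have hi := fun j => integrable_eval_mul_scaledKernel hr₀ hr₁ (T ℝ j)
  rw [integral_const_mul, integral_sub
    (f := fun y => (T ℝ (n + 1)).eval y * scaledKernel r y + (T ℝ (n + 2)).eval y * scaledKernel r y)
    (g := fun y => momentRatio r * ((T ℝ (n - 1)).eval y * scaledKernel r y +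
          (T ℝ n).eval y * scaledKernel r y))
    ((hi _).add (hi _)) (((hi _).add (hi _)).const_mul _), integral_const_mul,
    integral_add (hi _) (hi _), integral_add (hi _) (hi _)]
  change (r / 2) ^ (n + 1) * (chebyshevMoment r (n + 1) + chebyshevMoment r (n + 2) -
    momentRatio r * (chebyshevMoment r (n - 1) + chebyshevMoment r n)) = 0
  have hm := chebyshevMoment_add_two hr₀ hr₁
  rw [hm n]
  -- For `n = 0` the index `n - 1` is negative; both moments are then zero by evenness in `k`.
  have hm' : chebyshevMoment r (n + 1) = momentRatio r * chebyshevMoment r (n - 1) := by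
    cases n with
    | zero =>
      simp only [Nat.cast_zero, zero_add, zero_sub, chebyshevMoment_neg, chebyshevMoment_one,
        mul_zero]
    | succ n =>
      have := hm n
      push_cast
      rwa [add_sub_cancel_right, add_assoc, one_add_one_eq_two]
  rw [hm']
  ring

/-- With `z = r (w + w⁻¹) / 2`, the recurrence polynomials have a closed form in `w`. -/
theorem aeval_jacobiPoly_joukowski (h0 : β 0 = r / 2 * (1 + momentRatio r))
    (h1 : β 1 = -(r / 2) * momentRatio r) (hβ : ∀ n, 2 ≤ n → β n = 0)
    (hγ0 : γ 0 = r ^ 2 / 4 * (1 - momentRatio r ^ 2)) (hγ : ∀ n, 1 ≤ n → γ n = r ^ 2 / 4)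
    {z w v : ℂ} (hwv : w * v = 1) (hz : z = r / 2 * (w + v)) (n : ℕ) :
    (w + 1) * aeval z (jacobiPoly β γ (n + 1)) = (r / 2) ^ (n + 1) *
      (w ^ n * (w ^ 2 - momentRatio r) + v ^ (n + 1) * (1 - momentRatio r * w ^ 2)) := by
  induction n using Nat.twoStepInduction with
  | zero =>
    simp [jacobiPoly, h0, hz]
    linear_combination (r / 2 : ℂ) * (1 + momentRatio r * w) * hwv
  | one =>
    simp [jacobiPoly, h0, h1, hγ0, hz]
    have hv2 : w ^ 2 * v ^ 2 = 1 := by rw [← mul_pow, hwv, one_pow]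
    grind
  | more n ih₀ ih₁ =>
    rw [jacobiPoly, hβ _ (by omega), hγ _ (by omega)]
    simp only [map_sub, map_mul, aeval_X, aeval_C, map_zero, sub_zero, Complex.coe_algebraMap]
    push_cast
    have expand : (w + 1) * (z * aeval z (jacobiPoly β γ (n + 1 + 1)) -
        r ^ 2 / 4 * aeval z (jacobiPoly β γ (n + 1))) =
        z * ((w + 1) * aeval z (jacobiPoly β γ (n + 1 + 1))) -
          r ^ 2 / 4 * ((w + 1) * aeval z (jacobiPoly β γ (n + 1))) := by ring
    refine expand.trans ?_
    rw [ih₀, ih₁, hz]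
    linear_combination (r / 2 : ℂ) ^ (n + 3) * (w ^ n * (w ^ 2 - momentRatio r) +
      v ^ (n + 1) * (1 - momentRatio r * w ^ 2)) * hwv

end Parameters

/-! ### The complement of `[-r, r]`. -/

/-- `w` and `v` are the roots `z / r ± d`, `d² = (z / r)² - 1`, with product `1`. If neither lies
outside the unit circle, both lie on it and are conjugate, which puts `z = r Re w` in `[-r, r]`. -/
theorem exists_joukowski {r : ℝ} (hr₀ : 0 < r) {z : ℂ}
    (hz : z ∉ Complex.ofReal '' Set.Icc (-r) r) :
    ∃ w v : ℂ, w * v = 1 ∧ z = r / 2 * (w + v) ∧ 1 < ‖w‖ := by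
  have hr : (r : ℂ) ≠ 0 := by exact_mod_cast hr₀.ne'
  obtain ⟨d, hd⟩ := IsAlgClosed.exists_pow_nat_eq ((z / r) ^ 2 - 1) (n := 2) (by norm_num)
  have hmul : (z / r + d) * (z / r - d) = 1 := by linear_combination -hd
  have hsum : z = r / 2 * ((z / r + d) + (z / r - d)) := by field_simp; ring
  have hnorm : ‖z / r + d‖ * ‖z / r - d‖ = 1 := by rw [← norm_mul, hmul, norm_one]
  rcases lt_trichotomy ‖z / r + d‖ 1 with h | h | h
  · refine ⟨_, _, (mul_comm _ _).trans hmul, hsum.trans (by ring), ?_⟩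
    by_contra hle
    nlinarith [norm_nonneg (z / r + d), norm_nonneg (z / r - d)]
  · exfalso
    have hconj : z / r - d = (starRingEnd ℂ) (z / r + d) := by
      rw [← Complex.inv_eq_conj h]
      exact eq_inv_of_mul_eq_one_right hmul
    apply hz
    set w := z / r + d
    have hre : |w.re| ≤ 1 := h ▸ Complex.abs_re_le_norm w
    rw [abs_le] at hre
    refine ⟨r * w.re, ⟨by nlinarith, by nlinarith⟩, ?_⟩
    rw [hsum, hconj, Complex.add_conj]
    push_cast
    ring
  · exact ⟨_, _, hmul, hsum, h⟩

theorem integrable_pow_walkMeasure {r : ℝ} (hr₀ : 0 < r) (hr₁ : r < 1) (n : ℕ) :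
    Integrable (fun x : ℝ => x ^ n) (walkMeasure r (1 / r)) := by
  have := isFiniteMeasure_walkMeasure hr₀ hr₁
  refine Integrable.of_bound (by fun_prop) 1 ?_
  filter_upwards [ae_walkMeasure r (1 / r)] with x hx
  rw [norm_pow]
  refine pow_le_one₀ (norm_nonneg x) ?_
  rw [Real.norm_eq_abs, abs_le]
  constructor <;> linarith [hx.1, hx.2]

theorem exists_pos_le_norm_sub {r : ℝ} {z : ℂ} (hz : z ∉ Complex.ofReal '' Set.Icc (-r) r) :
    ∃ δ : ℝ, 0 < δ ∧ ∀ x ∈ Set.Icc (-r) r, δ ≤ ‖z - x‖ := by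
  have hcl : IsClosed (Complex.ofReal '' Set.Icc (-r) r) :=
    (isCompact_Icc.image Complex.continuous_ofReal).isClosed
  obtain ⟨δ, hδ, hball⟩ := Metric.isOpen_iff.1 hcl.isOpen_compl z hz
  refine ⟨δ, hδ, fun x hx => ?_⟩
  by_contra hlt
  refine hball (a := (x : ℂ)) ?_ ⟨x, hx, rfl⟩
  rw [Metric.mem_ball, dist_comm, dist_eq_norm]
  exact not_le.1 hlt

/-! ### Functions of the second kind and the error of the convergents. -/

/-- The functions of the second kind `∫ p(x) / (z - x) dμ(x)`. -/
noncomputable def secondKind (μ : Measure ℝ) (z : ℂ) (p : ℝ[X]) : ℂ :=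
  ∫ x : ℝ, ((p.eval x : ℝ) : ℂ) / (z - x) ∂μ

section ContinuedFraction

variable {μ : Measure ℝ} {z : ℂ} {δ : ℝ}

theorem integrable_eval_div (hμ : ∀ n : ℕ, Integrable (fun x : ℝ => x ^ n) μ) (hδ : 0 < δ)
    (h : ∀ᵐ x : ℝ ∂μ, δ ≤ ‖z - x‖) (p : ℝ[X]) :
    Integrable (fun x : ℝ => ((p.eval x : ℝ) : ℂ) / (z - x)) μ := by
  simp_rw [div_eq_mul_inv]
  refine (integrable_eval_of_integrable_pow hμ p).ofReal.mul_bdd (c := δ⁻¹)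
    (Measurable.aestronglyMeasurable (by fun_prop)) ?_
  filter_upwards [h] with x hx
  rw [norm_inv]
  exact inv_anti₀ hδ hx

theorem norm_secondKind_le (hμ : ∀ n : ℕ, Integrable (fun x : ℝ => x ^ n) μ) (hδ : 0 < δ)
    (h : ∀ᵐ x : ℝ ∂μ, δ ≤ ‖z - x‖) (p : ℝ[X]) :
    ‖secondKind μ z p‖ ≤ δ⁻¹ * ∫ x, |p.eval x| ∂μ := by
  rw [← integral_const_mul]
  refine norm_integral_le_of_norm_le
    ((integrable_eval_of_integrable_pow hμ p).abs.const_mul _) ?_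
  filter_upwards [h] with x hx
  rw [norm_div, Complex.norm_real, Real.norm_eq_abs, div_eq_mul_inv, mul_comm]
  exact mul_le_mul_of_nonneg_right (inv_anti₀ hδ hx) (abs_nonneg _)

/-- `x / (z - x) = z / (z - x) - 1`. -/
theorem secondKind_X_mul (hμ : ∀ n : ℕ, Integrable (fun x : ℝ => x ^ n) μ) (hδ : 0 < δ)
    (h : ∀ᵐ x : ℝ ∂μ, δ ≤ ‖z - x‖) (p : ℝ[X]) :
    secondKind μ z (X * p) = z * secondKind μ z p - ((∫ x, p.eval x ∂μ : ℝ) : ℂ) := by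
  unfold secondKind
  rw [← integral_const_mul, ← integral_complex_ofReal, ← integral_sub
    (g := fun x => ((p.eval x : ℝ) : ℂ)) ((integrable_eval_div hμ hδ h p).const_mul z) (integrable_eval_of_integrable_pow hμ p).ofReal]
  refine integral_congr_ae ?_
  filter_upwards [h] with x hx
  have hne : z - x ≠ 0 := norm_pos_iff.1 (hδ.trans_le hx)
  simp only [eval_mul, eval_X]
  push_cast
  field_simp
  ring

theorem secondKind_sub (hμ : ∀ n : ℕ, Integrable (fun x : ℝ => x ^ n) μ) (hδ : 0 < δ)
    (h : ∀ᵐ x : ℝ ∂μ, δ ≤ ‖z - x‖) (p q : ℝ[X]) :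
    secondKind μ z (p - q) = secondKind μ z p - secondKind μ z q := by
  unfold secondKind
  rw [← integral_sub (integrable_eval_div hμ hδ h p) (integrable_eval_div hμ hδ h q)]
  simp [sub_div]

theorem secondKind_C_mul (c : ℝ) (p : ℝ[X]) :
    secondKind μ z (C c * p) = c * secondKind μ z p := by
  unfold secondKind
  rw [← integral_const_mul]
  simp [mul_div_assoc]

theorem secondKind_one : secondKind μ z 1 = stieltjesTransform μ z := by
  simp [secondKind, stieltjesTransform]

theorem jacobiContFract_get (β γ : ℕ → ℝ) (z : ℂ) (n : ℕ) :
    (jacobiContFract β γ z).s.get? n = some ⟨jacobiNumerator γ n, z - β n⟩ := rfl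

theorem dens_jacobiContFract (β γ : ℕ → ℝ) (z : ℂ) (n : ℕ) :
    (jacobiContFract β γ z).dens n = aeval z (jacobiPoly β γ n) := by
  induction n using Nat.twoStepInduction with
  | zero => simp [jacobiPoly]
  | one =>
    rw [GenContFract.first_den_eq (jacobiContFract_get β γ z 0)]
    simp [jacobiPoly]
  | more n ih₀ ih₁ =>
    rw [GenContFract.dens_recurrence (jacobiContFract_get β γ z (n + 1)) ih₀ ih₁]
    simp [jacobiPoly, jacobiNumerator]
    ring

/-- The error of the numerators of the Jacobi continued fraction is a function of the second
kind. -/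
theorem secondKind_jacobiPoly [IsProbabilityMeasure μ] {β γ : ℕ → ℝ}
    (hμ : ∀ n : ℕ, Integrable (fun x : ℝ => x ^ n) μ) (hδ : 0 < δ)
    (h : ∀ᵐ x : ℝ ∂μ, δ ≤ ‖z - x‖)
    (h0 : ∀ n, ∫ x, (jacobiPoly β γ (n + 1)).eval x ∂μ = 0) (n : ℕ) :
    secondKind μ z (jacobiPoly β γ n) =
      (jacobiContFract β γ z).dens n * stieltjesTransform μ z -
        (jacobiContFract β γ z).nums n := by
  induction n using Nat.twoStepInduction with
  | zero =>
    rw [jacobiPoly, secondKind_one, GenContFract.zeroth_den_eq_one, GenContFract.zeroth_num_eq_h]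
    simp [jacobiContFract]
  | one =>
    rw [GenContFract.first_den_eq (jacobiContFract_get β γ z 0),
      GenContFract.first_num_eq (jacobiContFract_get β γ z 0), jacobiPoly,
      ← mul_one (X - C (β 0)), sub_mul, secondKind_sub hμ hδ h, secondKind_X_mul hμ hδ h,
      secondKind_C_mul, secondKind_one]
    simp [jacobiContFract, jacobiNumerator]
    ring
  | more n ih₀ ih₁ =>
    -- The inhomogeneous term of `secondKind_X_mul` is the integral of `jacobiPoly β γ (n + 1)`,
    -- zero by `h0`; thus both sides obey the same recurrence.
    rw [GenContFract.dens_recurrence (jacobiContFract_get β γ z (n + 1)) rfl rfl,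
      GenContFract.nums_recurrence (jacobiContFract_get β γ z (n + 1)) rfl rfl, jacobiPoly,
      sub_mul, secondKind_sub hμ hδ h, secondKind_sub hμ hδ h, secondKind_X_mul hμ hδ h,
      secondKind_C_mul, secondKind_C_mul, h0, ih₀, ih₁]
    simp only [jacobiNumerator, Complex.ofReal_zero]
    ring

theorem tendsto_convs_of_tendsto_secondKind_div [IsProbabilityMeasure μ] {β γ : ℕ → ℝ}
    (hμ : ∀ n : ℕ, Integrable (fun x : ℝ => x ^ n) μ) (hδ : 0 < δ)
    (h : ∀ᵐ x : ℝ ∂μ, δ ≤ ‖z - x‖)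
    (h0 : ∀ n, ∫ x, (jacobiPoly β γ (n + 1)).eval x ∂μ = 0)
    (hne : ∀ᶠ n in atTop, aeval z (jacobiPoly β γ n) ≠ 0)
    (hlim : Tendsto (fun n => secondKind μ z (jacobiPoly β γ n) / aeval z (jacobiPoly β γ n))
      atTop (𝓝 0)) :
    Tendsto (fun n => (jacobiContFract β γ z).convs n) atTop (𝓝 (stieltjesTransform μ z)) := by
  have := hlim.const_sub (stieltjesTransform μ z)
  rw [sub_zero] at this
  refine this.congr' ?_
  filter_upwards [hne] with n hn
  rw [secondKind_jacobiPoly hμ hδ h h0, GenContFract.conv_eq_num_div_den, dens_jacobiContFract]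
  field_simp
  ring

end ContinuedFraction

/-! ### Convergence of the continued fraction. -/

/-- AM-GM in place of Cauchy–Schwarz; `t` is to be chosen of the size of the `L²` norm. -/
theorem integral_abs_le {μ : Measure ℝ} [IsProbabilityMeasure μ]
    (hμ : ∀ n : ℕ, Integrable (fun x : ℝ => x ^ n) μ) (p : ℝ[X]) {t : ℝ} (ht : 0 < t) :
    ∫ x, |p.eval x| ∂μ ≤ ((∫ x, p.eval x ^ 2 ∂μ) / t + t) / 2 := by
  have hsq : Integrable (fun x => p.eval x ^ 2) μ := by
    simpa only [sq, eval_mul] using integrable_eval_of_integrable_pow hμ (p * p)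
  have hle : ∫ x, |p.eval x| ∂μ ≤ ∫ x, (p.eval x ^ 2 / t + t) / 2 ∂μ := by
    refine integral_mono (integrable_eval_of_integrable_pow hμ p).abs
      (((hsq.div_const t).add (integrable_const t)).div_const 2) fun x => ?_
    have : 2 * t * |p.eval x| ≤ p.eval x ^ 2 + t ^ 2 := by
      nlinarith [sq_nonneg (|p.eval x| - t), sq_abs (p.eval x)]
    show |p.eval x| ≤ (p.eval x ^ 2 / t + t) / 2
    rw [le_div_iff₀ two_pos, div_add' _ _ _ ht.ne', le_div_iff₀ ht]
    linarith
  rwa [integral_div, integral_add (hsq.div_const t) (integrable_const t), integral_div,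
    integral_const, probReal_univ, one_smul] at hle

section Parameters

variable {r : ℝ} {β γ : ℕ → ℝ}

/-- The first term dominates: `|q| ≤ 1 < |w|²` gives `w² ≠ q`, while `|v| ≤ 1` bounds the second. -/
theorem tendsto_norm_growth {w v : ℂ} (hwv : w * v = 1) (hw : 1 < ‖w‖) {q : ℝ} (hq : |q| ≤ 1) :
    Tendsto (fun n : ℕ => ‖w ^ n * (w ^ 2 - q) + v ^ (n + 1) * (1 - q * w ^ 2)‖) atTop atTop := by
  have hv : ‖v‖ ≤ 1 := by
    have : ‖w‖ * ‖v‖ = 1 := by rw [← norm_mul, hwv, norm_one]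
    by_contra hlt
    nlinarith [norm_nonneg v]
  have hpos : 0 < ‖w ^ 2 - q‖ := by
    have h1 := norm_sub_norm_le (w ^ 2) (q : ℂ)
    rw [norm_pow, Complex.norm_real, Real.norm_eq_abs] at h1
    nlinarith
  have hlim : Tendsto (fun n : ℕ => ‖w‖ ^ n * ‖w ^ 2 - q‖ - ‖1 - q * w ^ 2‖) atTop atTop :=
    tendsto_atTop_add_const_right _ _ ((tendsto_pow_atTop_atTop_of_one_lt hw).atTop_mul_const hpos)
  refine tendsto_atTop_mono (fun n => ?_) hlim
  have h1 := norm_sub_norm_le (w ^ n * (w ^ 2 - q)) (-(v ^ (n + 1) * (1 - q * w ^ 2)))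
  rw [sub_neg_eq_add, norm_neg, norm_mul, norm_mul, norm_pow, norm_pow] at h1
  have h2 : ‖v‖ ^ (n + 1) * ‖1 - q * w ^ 2‖ ≤ 1 * ‖1 - q * w ^ 2‖ :=
    mul_le_mul_of_nonneg_right (pow_le_one₀ (norm_nonneg v) hv) (norm_nonneg _)
  linarith

theorem tendsto_convs_walkMeasure (hr₀ : 0 < r) (hr₁ : r < 1)
    (h0 : β 0 = r / 2 * (1 + momentRatio r))
    (h1 : β 1 = -(r / 2) * momentRatio r) (hβ : ∀ n, 2 ≤ n → β n = 0)
    (hγ0 : γ 0 = r ^ 2 / 4 * (1 - momentRatio r ^ 2)) (hγ : ∀ n, 1 ≤ n → γ n = r ^ 2 / 4)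
    {z : ℂ} (hz : z ∉ Complex.ofReal '' Set.Icc (-r) r) :
    Tendsto (fun n => (jacobiContFract β γ z).convs n) atTop
      (𝓝 (stieltjesTransform (walkMeasure r (1 / r)) z)) := by
  have := isProbabilityMeasure_walkMeasure hr₀ hr₁
  have hμ := integrable_pow_walkMeasure hr₀ hr₁
  have hint := integral_jacobiPoly_eq_zero hr₀ hr₁ h0 h1 hβ hγ0 hγ
  obtain ⟨δ, hδ, hle⟩ := exists_pos_le_norm_sub hz
  have hδ' : ∀ᵐ x : ℝ ∂walkMeasure r (1 / r), δ ≤ ‖z - x‖ := by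
    filter_upwards [ae_walkMeasure r (1 / r)] with x hx using hle x (Set.Ioo_subset_Icc_self hx)
  obtain ⟨w, v, hwv, hzw, hw⟩ := exists_joukowski hr₀ hz
  have hq : |momentRatio r| ≤ 1 := by
    rw [abs_of_nonneg (momentRatio_nonneg r)]
    exact (momentRatio_lt_one hr₀ hr₁).le
  have hgrow := tendsto_norm_growth hwv hw hq
  set D : ℕ → ℂ := fun n =>
    w ^ n * (w ^ 2 - momentRatio r) + v ^ (n + 1) * (1 - momentRatio r * w ^ 2)
  have hP : ∀ n, (w + 1) * aeval z (jacobiPoly β γ (n + 1)) = (r / 2) ^ (n + 1) * D n :=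
    aeval_jacobiPoly_joukowski h0 h1 hβ hγ0 hγ hwv hzw
  have hw1 : w + 1 ≠ 0 := by
    intro hw0
    rw [eq_neg_of_add_eq_zero_left hw0, norm_neg, norm_one] at hw
    exact lt_irrefl _ hw
  have hr : (r : ℂ) ≠ 0 := by exact_mod_cast hr₀.ne'
  have hD : ∀ᶠ n in atTop, D n ≠ 0 := by
    filter_upwards [hgrow.eventually_gt_atTop 0] with n hn using norm_pos_iff.1 hn
  have hprod : ∀ n, ∏ i ∈ Finset.range (n + 1), γ i = γ 0 * ((r / 2) ^ n) ^ 2 := fun n => by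
    rw [Finset.prod_range_succ', mul_comm,
      Finset.prod_congr rfl fun i _ => hγ (i + 1) (by omega), Finset.prod_const,
      Finset.card_range, ← pow_mul, mul_comm n 2, pow_mul]
    congr 2
    ring
  have hbound : ∀ n, ‖secondKind (walkMeasure r (1 / r)) z (jacobiPoly β γ (n + 1))‖ ≤
      δ⁻¹ * ((γ 0 + 1) / 2 * (r / 2) ^ n) := fun n => by
    refine (norm_secondKind_le hμ hδ hδ' _).trans
      (mul_le_mul_of_nonneg_left ?_ (inv_nonneg.2 hδ.le))
    -- With `t = (r / 2) ^ n`, the squared norm `γ 0 * t ^ 2` makes the bound proportional to `t`.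
    have ht : 0 < (r / 2) ^ n := by positivity
    refine (integral_abs_le hμ _ ht).trans_eq ?_
    rw [integral_jacobiPoly_sq hμ hint, hprod]
    field_simp
  refine tendsto_convs_of_tendsto_secondKind_div hμ hδ hδ' hint ?_ ?_
  · obtain ⟨N, hN⟩ := eventually_atTop.1 hD
    filter_upwards [eventually_ge_atTop (N + 1)] with n hn hzero
    obtain ⟨m, rfl⟩ := Nat.exists_eq_succ_of_ne_zero (by omega : n ≠ 0)
    have hm := hP m
    rw [hzero, mul_zero] at hm
    exact mul_ne_zero (pow_ne_zero _ (div_ne_zero hr two_ne_zero)) (hN m (by omega)) hm.symm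
  -- The closed form covers index `n + 1` only. In the quotient `(r / 2) ^ n` cancels, leaving `2 /
  -- r`, the factor `‖w + 1‖` and the decaying `‖D n‖⁻¹`.
  · rw [← tendsto_add_atTop_iff_nat 1]
    have hlim : Tendsto (fun n => δ⁻¹ * ((γ 0 + 1) / 2) * (2 / r) * ‖w + 1‖ * ‖D n‖⁻¹)
        atTop (𝓝 0) := by
      simpa using hgrow.inv_tendsto_atTop.const_mul (δ⁻¹ * ((γ 0 + 1) / 2) * (2 / r) * ‖w + 1‖)
    refine squeeze_zero_norm' ?_ hlim
    filter_upwards [hD] with n hn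
    have hPn : aeval z (jacobiPoly β γ (n + 1)) = (r / 2) ^ (n + 1) * D n / (w + 1) := by
      rw [eq_div_iff hw1, ← hP n, mul_comm]
    have hDn := norm_pos_iff.2 hn
    have hw1n := norm_pos_iff.2 hw1
    have hrn : ‖(r / 2 : ℂ)‖ = r / 2 := by
      rw [norm_div, Complex.norm_real, Real.norm_of_nonneg hr₀.le, RCLike.norm_ofNat]
    rw [hPn, norm_div, norm_div, norm_mul, norm_pow, hrn, div_le_iff₀ (by positivity)]
    refine (hbound n).trans_eq ?_
    rw [pow_succ]
    field_simp

end Parameters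

theorem proposition4p3 (r : ℝ) (hr₀ : 0 < r) (hr₁ : r < 1) :
    IsProbabilityMeasure (walkMeasure r (1 / r)) ∧
    (∀ β γ : ℕ → ℝ, IsJacobiParameters (walkMeasure r (1 / r)) β γ ↔
      β 0 = (1 - √(1 - r ^ 2)) / r ∧
      β 1 = -(1 - √(1 - r ^ 2)) ^ 2 / (2 * r) ∧
      (∀ n, 2 ≤ n → β n = 0) ∧
      γ 0 = √(1 - r ^ 2) * (1 - √(1 - r ^ 2)) ^ 2 / r ^ 2 ∧
      (∀ n, 1 ≤ n → γ n = r ^ 2 / 4)) ∧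
    (∀ β γ : ℕ → ℝ, IsJacobiParameters (walkMeasure r (1 / r)) β γ →
      ∀ z : ℂ, z ∉ Complex.ofReal '' Set.Icc (-r) r →
        Tendsto (fun n => (jacobiContFract β γ z).convs n) atTop
          (𝓝 (stieltjesTransform (walkMeasure r (1 / r)) z))) := by
  have := isProbabilityMeasure_walkMeasure hr₀ hr₁
  obtain ⟨e₀, e₁, e₂⟩ := parameters_eq_momentRatio hr₀ hr₁
  rw [e₀, e₁, e₂]
  have hμ := integrable_pow_walkMeasure hr₀ hr₁
  have hq := momentRatio_lt_one hr₀ hr₁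
  have hq₀ := momentRatio_nonneg r
  have hback : ∀ β γ : ℕ → ℝ, (β 0 = r / 2 * (1 + momentRatio r) ∧
      β 1 = -(r / 2) * momentRatio r ∧ (∀ n, 2 ≤ n → β n = 0) ∧
      γ 0 = r ^ 2 / 4 * (1 - momentRatio r ^ 2) ∧ ∀ n, 1 ≤ n → γ n = r ^ 2 / 4) →
      IsJacobiParameters (walkMeasure r (1 / r)) β γ := by
    rintro β γ ⟨h0, h1, hβ, hγ0, hγ⟩
    refine ⟨hμ, jacobiPoly β γ, isMonicOrthogonal_jacobiPoly hμ
      (integral_jacobiPoly_eq_zero hr₀ hr₁ h0 h1 hβ hγ0 hγ) fun n => ?_,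
      X_mul_jacobiPoly_zero β γ, X_mul_jacobiPoly_succ β γ⟩
    cases n with
    | zero =>
      rw [hγ0]
      have : 0 < 1 - momentRatio r ^ 2 := by nlinarith
      positivity
    | succ n =>
      rw [hγ _ (by omega)]
      positivity
  have hforward : ∀ β γ : ℕ → ℝ, IsJacobiParameters (walkMeasure r (1 / r)) β γ →
      β 0 = r / 2 * (1 + momentRatio r) ∧
      β 1 = -(r / 2) * momentRatio r ∧ (∀ n, 2 ≤ n → β n = 0) ∧
      γ 0 = r ^ 2 / 4 * (1 - momentRatio r ^ 2) ∧ ∀ n, 1 ≤ n → γ n = r ^ 2 / 4 := by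
    intro β γ h
    -- The explicit sequences are Jacobi parameters by `hback`, so uniqueness identifies `β` and `γ`
    -- with them.
    have hex := hback
      (fun n => if n = 0 then r / 2 * (1 + momentRatio r) else
        if n = 1 then -(r / 2) * momentRatio r else 0)
      (fun n => if n = 0 then r ^ 2 / 4 * (1 - momentRatio r ^ 2) else r ^ 2 / 4)
      ⟨by simp, by simp, fun n hn => by simp [show n ≠ 0 by omega, show n ≠ 1 by omega],
        by simp, fun n hn => by simp [show n ≠ 0 by omega]⟩
    obtain ⟨rfl, rfl⟩ := h.unique hex
    exact ⟨by simp, by simp, fun n hn => by simp [show n ≠ 0 by omega, show n ≠ 1 by omega],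
        by simp, fun n hn => by simp [show n ≠ 0 by omega]⟩
  refine ⟨this, fun β γ => ⟨hforward β γ, hback β γ⟩, fun β γ h z hz => ?_⟩
  obtain ⟨h0, h1, hβ, hγ0, hγ⟩ := hforward β γ h
  exact tendsto_convs_walkMeasure hr₀ hr₁ h0 h1 hβ hγ0 hγ hz
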